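/- All graphs are finite and simple. For vertices $u,v$ of a connected graph $\Gamma$ let $d(u,v)$ be their distance in $\Gamma$. A $3$-term arithmetic progression in $\Gamma$ is a triple of vertices $v_1,v_2,v_3$ with $d(v_1,v_2)=d(v_2,v_3)$. An exact $r$-coloring of $\Gamma$ is a surjective function $c:V(\Gamma)\to\{1,\dots,r\}$, and a $3$-term arithmetic progression is rainbow under $c$ if its three terms receive pairwise distinct colors. The anti-van der Waerden number $\operatorname{aw}(\Gamma,3)$ is the least positive integer $r$ such that every exact $r$-coloring of $\Gamma$ contains a rainbow $3$-term arithmetic progression (in particular $\operatorname{aw}(\Gamma,3)\le |V(\Gamma)|+1$, since there is no exact $r$-coloring when $r>|V(\Gamma)|$). $G\square H$ denotes the Cartesian product of graphs. **Theorem.** If $G$ and $H$ are connected graphs with at least $2$ vertices each, then $$\operatorname{aw}(G\square H,3)\le 4 .$$ Moreover, every exact $4$-coloring of $G\square H$ contains a rainbow $3$-term arithmetic progression. -/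

import Mathlib

/-- `v 0, v 1, …, v (k - 1)` is a `k`-term arithmetic progression of the graph `G`:
consecutive terms are all at one and the same graph distance `d`. -/
def SimpleGraph.IsAP {V : Type*} (G : SimpleGraph V) {k : ℕ} (v : Fin k → V) : Prop :=
  ∃ d : ℕ, ∀ (i : ℕ) (hi : i + 1 < k),
    G.dist (v ⟨i, Nat.lt_of_succ_lt hi⟩) (v ⟨i + 1, hi⟩) = d

/-- The coloring `c` has a rainbow `k`-term arithmetic progression: one whose `k` terms
receive pairwise distinct colors (in particular the progression is non-degenerate). -/
def SimpleGraph.HasRainbowAP {V C : Type*} (G : SimpleGraph V) (c : V → C) (k : ℕ) : Prop :=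
  ∃ v : Fin k → V, G.IsAP v ∧ Function.Injective (fun i => c (v i))

/-- Every exact `r`-coloring of `G` (a surjection from the vertices onto `r` colors)
contains a rainbow `k`-term arithmetic progression. -/
def SimpleGraph.ForcesRainbowAP {V : Type*} (G : SimpleGraph V) (r k : ℕ) : Prop :=
  ∀ c : V → Fin r, Function.Surjective c → G.HasRainbowAP c k

/-- The anti-van der Waerden number `aw(G, k)`: the least positive integer `r` such that
every exact `r`-coloring of `G` contains a rainbow `k`-term arithmetic progression. -/
noncomputable def SimpleGraph.aw {V : Type*} (G : SimpleGraph V) (k : ℕ) : ℕ :=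
  sInf {r : ℕ | 0 < r ∧ G.ForcesRainbowAP r k}

/-- A finite graph has no exact coloring with more colors than vertices, so the minimum
that defines `aw` is attained. -/
theorem SimpleGraph.aw_spec {V : Type*} [Finite V] (G : SimpleGraph V) (k : ℕ) :
    0 < G.aw k ∧ G.ForcesRainbowAP (G.aw k) k := by
  have hne : {r : ℕ | 0 < r ∧ G.ForcesRainbowAP r k}.Nonempty := by
    refine ⟨Nat.card V + 1, Nat.succ_pos _, fun c hc => ?_⟩
    have h := Nat.card_le_card_of_surjective c hc
    simp at h
  exact Nat.sInf_mem hne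

namespace SimpleGraph

variable {V W C : Type*} {G : SimpleGraph V} {H : SimpleGraph W} {c : V → W → C}

/-! Suppose a 4-coloring is rainbow-free. Distances add in the product, and every fiber has at most
two colors (`twoValued_left`). Join two colors when they share a `G`-fiber: no color is isolated
(`exists_ne`) and no two edges are disjoint (`not_disjoint`), so the four colors form a star with
some center `r`. The `H`-fibers give the same center (`eq_of_swap`). A closest pair of distinctly
colored non-`r` vertices, played against a vertex of the third non-`r` color, then yields a
contradiction (`false_of_minimal`). -/

theorem Connected.exists_adj_of_mem_of_notMem (hG : G.Connected) {P : V → Prop} {x y : V}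
    (hx : P x) (hy : ¬ P y) : ∃ u v, G.Adj u v ∧ P u ∧ ¬ P v := by
  obtain ⟨p⟩ := hG x y
  obtain ⟨d, -, h1, h2⟩ := p.exists_boundary_dart {z | P z} hx hy
  exact ⟨d.fst, d.snd, d.adj, h1, h2⟩

theorem Connected.exists_adj_apply_ne (hG : G.Connected) {f : V → C} {x y : V}
    (h : f x ≠ f y) : ∃ u v, G.Adj u v ∧ f u ≠ f v := by
  obtain ⟨u, v, huv, hu, hv⟩ :=
    hG.exists_adj_of_mem_of_notMem (P := fun z => f z = f x) rfl (fun e => h e.symm)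
  exact ⟨u, v, huv, fun e => hv (e ▸ hu)⟩

theorem Connected.exists_adj_dist_add_one (hG : G.Connected) {x y : V} (h : x ≠ y) :
    ∃ z, G.Adj x z ∧ G.dist z y + 1 = G.dist x y := by
  obtain ⟨p, hp⟩ := hG.exists_walk_length_eq_dist x y
  cases p with
  | nil => exact absurd rfl h
  | @cons _ z _ hxz q =>
    refine ⟨z, hxz, ?_⟩
    have h1 := dist_le q
    have h2 := hG.dist_triangle (u := x) (v := z) (w := y)
    rw [dist_eq_one_iff_adj.2 hxz] at h2
    simp only [Walk.length_cons] at hp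
    omega

theorem Connected.dist_boxProd (hG : G.Connected) (hH : H.Connected) (x y : V × W) :
    (G.boxProd H).dist x y = G.dist x.1 y.1 + H.dist x.2 y.2 := by
  have h := edist_boxProd (G := G) (H := H) x y
  rw [← ((hG.boxProd hH) x y).coe_dist_eq_edist, ← (hG x.1 y.1).coe_dist_eq_edist,
    ← (hH x.2 y.2).coe_dist_eq_edist] at h
  exact_mod_cast h

/-- No three vertices of the box product of `G` and `H`, the first and the last equally far from
the middle one (for the sum of the two distances), have pairwise distinct colors. -/
def RainbowFree (G : SimpleGraph V) (H : SimpleGraph W) (c : V → W → C) : Prop :=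
  ∀ x y z h k l, G.dist x y + H.dist h k = G.dist y z + H.dist k l →
    c x h = c y k ∨ c y k = c z l ∨ c x h = c z l

theorem RainbowFree.swap (hc : RainbowFree G H c) : RainbowFree H G (fun h x => c x h) :=
  fun h k l x y z e => hc x y z h k l (by omega)

/-- At most two values are attained. -/
def TwoValued {X : Type*} (f : X → C) : Prop :=
  ∀ x y z, f x = f y ∨ f y = f z ∨ f x = f z

/-- Three vertices of a unit square are never rainbow. -/
theorem RainbowFree.square (hc : RainbowFree G H c) {x y : V} {h k : W} (hxy : G.Adj x y)
    (hhk : H.Adj h k) : c y h = c x h ∨ c x h = c x k ∨ c y h = c x k :=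
  hc y x x h h k (by
    simp [dist_eq_one_iff_adj.2 hxy.symm, dist_eq_one_iff_adj.2 hhk])

/-! ### Fibers have at most two colors -/

theorem Connected.exists_min_of_not_twoValued (hG : G.Connected) {f : V → C}
    (hf : ¬ TwoValued f) : ∃ x y z, G.Adj x y ∧ f x ≠ f y ∧ f z ≠ f x ∧ f z ≠ f y ∧
      ∀ x' y' z', G.Adj x' y' → f x' ≠ f y' → f z' ≠ f x' → f z' ≠ f y' →
        G.dist y z ≤ G.dist y' z' := by
  let S : Set (V × V × V) :=
    {t | G.Adj t.1 t.2.1 ∧ f t.1 ≠ f t.2.1 ∧ f t.2.2 ≠ f t.1 ∧ f t.2.2 ≠ f t.2.1}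
  have hS : S.Nonempty := by
    simp only [TwoValued, not_forall, not_or] at hf
    obtain ⟨a, b, d, hab, hbd, had⟩ := hf
    obtain ⟨x, y, hxy, hne⟩ := hG.exists_adj_apply_ne hab
    have : ∃ z, f z ≠ f x ∧ f z ≠ f y := by
      by_contra! hcon
      have h1 := or_iff_not_imp_left.2 (hcon a)
      have h2 := or_iff_not_imp_left.2 (hcon b)
      have h3 := or_iff_not_imp_left.2 (hcon d)
      grind
    obtain ⟨z, h1, h2⟩ := this
    exact ⟨(x, y, z), hxy, hne, h1, h2⟩
  obtain ⟨⟨x, y, z⟩, ⟨h1, h2, h3, h4⟩, hmin⟩ :=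
    (measure fun t : V × V × V => G.dist t.2.1 t.2.2).wf.has_min S hS
  refine ⟨x, y, z, h1, h2, h3, h4, fun x' y' z' k1 k2 k3 k4 => ?_⟩
  exact not_lt.1 (hmin (x', y', z') ⟨k1, k2, k3, k4⟩)

/-- In a three-colored fiber, take a bichromatic edge `x y` and a third-colored `z` with `y`, `z`
closest. Geodesics from `y` to `z` keep the color of `y` until `z`; a neighboring fiber then
completes a rainbow progression. -/
theorem RainbowFree.twoValued_left (hc : RainbowFree G H c) (hG : G.Connected)
    {h h' : W} (hh : H.Adj h h') : TwoValued (fun x => c x h) := by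
  by_contra hf
  obtain ⟨x, y, z, hxy, nxy, nzx, nzy, hmin⟩ := hG.exists_min_of_not_twoValued hf
  have tri := fun a b d : V => hG.dist_triangle (u := a) (v := b) (w := d)
  have dxy := dist_eq_one_iff_adj.2 hxy
  have dh := dist_eq_one_iff_adj.2 hh
  have dh' := dist_eq_one_iff_adj.2 hh.symm
  have hxz : G.dist x z = G.dist y z + 1 := by
    have h1 := tri x y z
    have h2 := hmin y x z hxy.symm nxy.symm nzy nzx
    have h3 : G.dist x z ≠ G.dist y z := fun e => by
      have := hc x z y h h h (by rw [G.dist_comm (u := z) (v := y)]; simpa using e)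
      grind
    omega
  -- At a first color change `q p`, either `q p` is a bichromatic edge closer to `z`, or `p`
  -- replaces `z` for the edge `x y`.
  have key : ∀ n p, G.dist y p = n → G.dist y p + G.dist p z = G.dist y z → p ≠ z →
      c p h = c y h := by
    intro n
    induction n with
    | zero =>
      intro p hp _ _
      rw [hG.dist_eq_zero_iff] at hp
      rw [hp]
    | succ n ih =>
      intro p hp hpz hne
      have hpy : p ≠ y := by rintro rfl; simp at hp
      obtain ⟨q, hpq, hq⟩ := hG.exists_adj_dist_add_one hpy
      rw [G.dist_comm (u := q), G.dist_comm (u := p) (v := y)] at hq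
      have dpq := dist_eq_one_iff_adj.2 hpq.symm
      have t1 := tri q p z
      have t2 := tri y q z
      have hqz : q ≠ z := by rintro rfl; omega
      have hcq := ih q (by omega) (by omega) hqz
      by_contra hcp
      by_cases hpx : c p h = c x h
      · have := hmin q p z hpq.symm (by grind) (by grind) (by grind)
        omega
      · have := hmin x y p hxy nxy hpx hcp
        have hpos := hG.pos_dist_of_ne hne
        omega
  have hzy : z ≠ y := by rintro rfl; exact nzy rfl
  have hpos := hG.pos_dist_of_ne hzy.symm
  obtain ⟨p, hzp, hp⟩ := hG.exists_adj_dist_add_one hzy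
  have dzp := dist_eq_one_iff_adj.2 hzp
  have dpz := dist_eq_one_iff_adj.2 hzp.symm
  rw [G.dist_comm (u := p), G.dist_comm (u := z) (v := y)] at hp
  have hcp := key _ p rfl (by omega) hzp.ne'
  have hpy : p ≠ y := by
    rintro rfl
    have := hc x p z h h h (by simp [dxy, dpz])
    grind
  obtain ⟨r, hpr, hr⟩ := hG.exists_adj_dist_add_one hpy
  rw [G.dist_comm (u := r), G.dist_comm (u := p) (v := y)] at hr
  have drp := dist_eq_one_iff_adj.2 hpr.symm
  have t1 := tri r p z
  have t2 := tri y r z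
  have t3 := tri x y p
  have t4 := tri x p z
  have hrz : r ≠ z := by rintro rfl; omega
  have hcr := key _ r rfl (by omega) hrz
  have hxp : G.dist x p = G.dist y z := by omega
  -- `e1` and `e3` give `(p, h')` the color of `z`; `e2` and `e4` give `(y, h')` the color of `x`.
  -- With `(r, h)`, colored like `y`, `e5` is then violated.
  have e1 := hc z x p h h h' (by rw [G.dist_comm (u := z)]; simp only [dist_self]; omega)
  have e2 := hc x z y h h h' (by rw [G.dist_comm (u := z)]; simp only [dist_self]; omega)
  have e3 := hc.square hzp.symm hh
  have e4 := hc.square hxy.symm hh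
  have e5 := hc p y r h' h' h (by rw [G.dist_comm (u := p)]; simp only [dist_self]; omega)
  grind

/-! ### The star of colors sharing a fiber -/

/-- Both families of fibers are two-valued, and so are the unit squares. -/
structure LocallyTwoValued (G : SimpleGraph V) (H : SimpleGraph W) (c : V → W → C) : Prop where
  left : ∀ h, TwoValued fun x => c x h
  right : ∀ x, TwoValued fun h => c x h
  square : ∀ {x y h k}, G.Adj x y → H.Adj h k → c y h = c x h ∨ c x h = c x k ∨ c y h = c x k

theorem LocallyTwoValued.swap (hc : LocallyTwoValued G H c) :
    LocallyTwoValued H G (fun h x => c x h) :=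
  ⟨hc.right, hc.left, fun a b => by have := hc.square b a; grind⟩

theorem Connected.exists_adj [Nontrivial V] (hG : G.Connected) (x : V) : ∃ y, G.Adj x y := by
  obtain ⟨y, hy⟩ := exists_ne x
  obtain ⟨z, hz, -⟩ := hG.exists_adj_dist_add_one hy.symm
  exact ⟨z, hz⟩

theorem RainbowFree.locallyTwoValued [Nontrivial V] [Nontrivial W] (hc : RainbowFree G H c)
    (hG : G.Connected) (hH : H.Connected) : LocallyTwoValued G H c where
  left h := by
    obtain ⟨_, hh⟩ := hH.exists_adj h
    exact hc.twoValued_left hG hh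
  right x := by
    obtain ⟨_, hx⟩ := hG.exists_adj x
    exact hc.swap.twoValued_left hH hx
  square := hc.square

/-- Two `G`-fibers cannot carry two disjoint pairs of colors. -/
theorem LocallyTwoValued.not_disjoint (hc : LocallyTwoValued G H c) (hG : G.Connected)
    (hH : H.Connected) {h k : W} {x y z t : V} (hxy : c x h ≠ c y h) (hzt : c z k ≠ c t k)
    (hxz : c x h ≠ c z k) (hxt : c x h ≠ c t k) (hyz : c y h ≠ c z k) (hyt : c y h ≠ c t k) :
    False := by
  have hh : ∀ p, c p h = c x h ∨ c p h = c y h := fun p => by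
    have := hc.left h x y p; grind
  have hk : ∀ p, c p k = c z k ∨ c p k = c t k := fun p => by
    have := hc.left k z t p; grind
  have hhk : ∀ p q, c p h ≠ c q k := fun p q => by
    have := hh p; have := hk q; grind
  -- Where the `H`-fiber of `p` first leaves its color, the square forces `(p', s)` to the color of
  -- `(p, k)`; then `p`, `p'`, `q` show three colors at level `s`.
  have main : ∀ p p' q, G.Adj p p' → c p h ≠ c p' h → c p k = c p' k → c q h = c p' h →
      c q k ≠ c p k → False := by
    intro p p' q hpp e1 e2 e3 e4
    obtain ⟨s, s', hss, hs, hs'⟩ := hH.exists_adj_of_mem_of_notMem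
      (P := fun l => c p l = c p h) rfl (fun e => hhk p p e.symm)
    have a1 := hc.right p h k s'
    have a2 := hc.right p' h k s
    have a3 := hc.right q h k s
    have a4 := hc.left s p p' q
    have a5 := hc.square hpp hss
    have b1 := hhk p p
    have b2 := hhk p' p'
    have b3 := hhk q q
    have b4 := hhk p q
    grind
  obtain ⟨p, p', hpp, hne⟩ := hG.exists_adj_apply_ne (f := fun q => c q h) hxy
  have hs : c p k = c p' k := by
    by_contra hs
    obtain ⟨s, s', hss, hs, hs'⟩ := hH.exists_adj_of_mem_of_notMem
      (P := fun l => c p l = c p h) rfl (fun e => hhk p p e.symm)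
    have a1 := hc.right p h k s'
    have a2 := hc.right p' h k s
    have a3 := hc.right p' h k s'
    have a5 := hc.square hpp hss
    have a6 := hc.square hpp hss.symm
    have a7 := hc.square hpp.symm hss
    have a8 := hc.square hpp.symm hss.symm
    have b1 := hhk p p
    have b2 := hhk p' p'
    have b3 := hhk p' p
    have b4 := hhk p p'
    grind
  obtain ⟨q, hq⟩ : ∃ q, c q k ≠ c p k := by
    by_contra! hcon
    exact hzt ((hcon z).trans (hcon t).symm)
  have h1 := hh p
  have h2 := hh p'
  have h3 := hh q
  by_cases hqp : c q h = c p' h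
  · exact main p p' q hpp hne hs hqp hq
  · exact main p' p q hpp.symm hne.symm hs.symm (by grind) (by rwa [← hs])

/-- If three colors occur, every color shares a `G`-fiber with another one. -/
theorem LocallyTwoValued.exists_ne (hc : LocallyTwoValued G H c) (hG : G.Connected)
    (hH : H.Connected) (h3 : ∀ i j : C, ∃ x h, c x h ≠ i ∧ c x h ≠ j) (x : V) (h : W) :
    ∃ y z k, c y k = c x h ∧ c z k ≠ c x h := by
  -- Now every `G`-fiber meeting this color is constant. The next fiber without it is constant too,
  -- by the squares, so a third color would give an `H`-fiber three colors.
  by_contra! hcon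
  obtain ⟨a, k, hk, -⟩ := h3 (c x h) (c x h)
  obtain ⟨l, l', hll, hl, hl'⟩ := hH.exists_adj_of_mem_of_notMem
    (P := fun l => c a l = c x h) (hcon x a h rfl) hk
  have hl : ∀ y, c y l = c x h := fun y => hcon a y l hl
  have hl'' : ∀ y, c y l' ≠ c x h := fun y e => hl' (hcon y a l' e)
  by_cases hmono : ∀ y, c y l' = c a l'
  · obtain ⟨y, m, h1, h2⟩ := h3 (c x h) (c a l')
    have := hc.right y l l' m
    grind
  · push Not at hmono
    obtain ⟨b, hb⟩ := hmono
    obtain ⟨p, q, hpq, hne⟩ := hG.exists_adj_apply_ne (f := fun y => c y l') hb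
    have := hc.square hpq hll.symm
    grind

/-- On four points, a graph without isolated vertices or disjoint edges is a star. -/
theorem exists_center_of_fin_four (E : Fin 4 → Fin 4 → Prop) (hs : ∀ i j, E i j → E j i)
    (hi : ∀ i, ∃ j, j ≠ i ∧ E i j)
    (hd : ∀ i j k l, E i j → E k l → i ≠ j → k ≠ l → i ≠ k → i ≠ l → j ≠ k → j ≠ l → False) :
    ∃ r, ∀ i j, E i j → i ≠ j → i = r ∨ j = r := by
  have d1 : ¬ (E 0 1 ∧ E 2 3) := fun h => hd 0 1 2 3 h.1 h.2 (by decide) (by decide)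
    (by decide) (by decide) (by decide) (by decide)
  have d2 : ¬ (E 0 2 ∧ E 1 3) := fun h => hd 0 2 1 3 h.1 h.2 (by decide) (by decide)
    (by decide) (by decide) (by decide) (by decide)
  have d3 : ¬ (E 0 3 ∧ E 1 2) := fun h => hd 0 3 1 2 h.1 h.2 (by decide) (by decide)
    (by decide) (by decide) (by decide) (by decide)
  have i0 : E 0 1 ∨ E 0 2 ∨ E 0 3 := by
    obtain ⟨j, hj, hE⟩ := hi 0
    clear hs hi hd d1 d2 d3
    fin_cases j <;> simp_all
  have i1 : E 0 1 ∨ E 1 2 ∨ E 1 3 := by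
    obtain ⟨j, hj, hE⟩ := hi 1
    have := hs 1 j hE
    clear hs hi hd d1 d2 d3 i0
    fin_cases j <;> simp_all
  have i2 : E 0 2 ∨ E 1 2 ∨ E 2 3 := by
    obtain ⟨j, hj, hE⟩ := hi 2
    have := hs 2 j hE
    clear hs hi hd d1 d2 d3 i0 i1
    fin_cases j <;> simp_all
  have i3 : E 0 3 ∨ E 1 3 ∨ E 2 3 := by
    obtain ⟨j, hj, hE⟩ := hi 3
    have := hs 3 j hE
    clear hs hi hd d1 d2 d3 i0 i1 i2
    fin_cases j <;> simp_all
  have star : (¬ E 1 2 ∧ ¬ E 1 3 ∧ ¬ E 2 3) ∨ (¬ E 0 2 ∧ ¬ E 0 3 ∧ ¬ E 2 3) ∨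
      (¬ E 0 1 ∧ ¬ E 0 3 ∧ ¬ E 1 3) ∨ (¬ E 0 1 ∧ ¬ E 0 2 ∧ ¬ E 1 2) := by
    clear hs hi hd
    by_cases E 0 1 <;> by_cases E 0 2 <;> by_cases E 0 3 <;> simp_all
  clear hi hd d1 d2 d3 i0 i1 i2 i3
  rcases star with ⟨h1, h2, h3⟩ | ⟨h1, h2, h3⟩ | ⟨h1, h2, h3⟩ | ⟨h1, h2, h3⟩
  · refine ⟨0, fun i j hE hne => ?_⟩
    have := hs i j hE
    clear hs
    fin_cases i <;> fin_cases j <;> simp_all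
  · refine ⟨1, fun i j hE hne => ?_⟩
    have := hs i j hE
    clear hs
    fin_cases i <;> fin_cases j <;> simp_all
  · refine ⟨2, fun i j hE hne => ?_⟩
    have := hs i j hE
    clear hs
    fin_cases i <;> fin_cases j <;> simp_all
  · refine ⟨3, fun i j hE hne => ?_⟩
    have := hs i j hE
    clear hs
    fin_cases i <;> fin_cases j <;> simp_all

/-- Every `G`-fiber uses, besides the color `r`, at most one color. -/
def Dominated (c : V → W → C) (r : C) : Prop :=
  ∀ x y h, c x h ≠ r → c y h ≠ r → c x h = c y h

theorem exists_apply_ne_of_surjective {c : V → W → Fin 4}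
    (hs : ∀ i, ∃ x h, c x h = i) (i j k : Fin 4) :
    ∃ x h, c x h ≠ i ∧ c x h ≠ j ∧ c x h ≠ k := by
  obtain ⟨l, hl⟩ : ∃ l : Fin 4, l ≠ i ∧ l ≠ j ∧ l ≠ k := by revert i j k; decide
  obtain ⟨x, h, rfl⟩ := hs l
  exact ⟨x, h, hl⟩

theorem LocallyTwoValued.exists_dominated {c : V → W → Fin 4} (hc : LocallyTwoValued G H c)
    (hG : G.Connected) (hH : H.Connected) (hs : ∀ i, ∃ x h, c x h = i) :
    ∃ r, Dominated c r := by
  obtain ⟨r, hr⟩ := exists_center_of_fin_four (fun i j => ∃ x y h, c x h = i ∧ c y h = j)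
    (fun i j ⟨x, y, h, hx, hy⟩ => ⟨y, x, h, hy, hx⟩)
    (fun i => by
      obtain ⟨x, h, rfl⟩ := hs i
      obtain ⟨y, z, k, h1, h2⟩ := hc.exists_ne hG hH (fun i j => by
        obtain ⟨x, h, h1, h2, -⟩ := exists_apply_ne_of_surjective hs i j j
        exact ⟨x, h, h1, h2⟩) x h
      exact ⟨c z k, h2, y, z, k, h1, rfl⟩)
    (by
      rintro _ _ _ _ ⟨x, y, h, rfl, rfl⟩ ⟨z, t, k, rfl, rfl⟩ h1 h2 h3 h4 h5 h6
      exact hc.not_disjoint hG hH h1 h2 h3 h4 h5 h6)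
  refine ⟨r, fun x y h h1 h2 => ?_⟩
  by_contra hne
  rcases hr _ _ ⟨x, y, h, rfl, rfl⟩ hne with e | e
  exacts [h1 e, h2 e]

/-- If the centers differed, take `(x, h)` and `(y, k)` of distinct colors, with `(x, h)` avoiding
both centers and `(y, k)` too: no color is left for the corner `(x, k)`. -/
theorem Dominated.eq_of_swap {c : V → W → Fin 4} {r s : Fin 4} (hr : Dominated c r)
    (hs : Dominated (fun h x => c x h) s) (hsurj : ∀ i, ∃ x h, c x h = i) : r = s := by
  by_contra hrs
  obtain ⟨x, h, h1, h2, -⟩ := exists_apply_ne_of_surjective hsurj r s s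
  obtain ⟨y, k, h3, h4, h5⟩ := exists_apply_ne_of_surjective hsurj r s (c x h)
  have a1 := hr x y k
  have a2 := hs h k x
  grind

/-! ### A closest pair of non-central colors -/

theorem RainbowFree.false_of_minimal (hc : RainbowFree G H c) (hG : G.Connected)
    (hH : H.Connected) {r : C} (hl : Dominated c r) (hr : Dominated (fun h x => c x h) r)
    {u v w : V × W} (hur : c u.1 u.2 ≠ r) (hvr : c v.1 v.2 ≠ r) (hwr : c w.1 w.2 ≠ r)
    (huv : c u.1 u.2 ≠ c v.1 v.2) (hwu : c w.1 w.2 ≠ c u.1 u.2) (hwv : c w.1 w.2 ≠ c v.1 v.2)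
    (hmin : ∀ p q : V × W, c p.1 p.2 ≠ r → c q.1 q.2 ≠ r → c p.1 p.2 ≠ c q.1 q.2 →
      G.dist u.1 v.1 + H.dist u.2 v.2 ≤ G.dist p.1 q.1 + H.dist p.2 q.2)
    (hmin' : ∀ p q : V × W, c p.1 p.2 ≠ r → c q.1 q.2 ≠ r → c p.1 p.2 ≠ c q.1 q.2 →
      G.dist p.1 q.1 + H.dist p.2 q.2 = G.dist u.1 v.1 + H.dist u.2 v.2 →
      H.dist u.2 v.2 ≤ H.dist p.2 q.2)
    (hlt : G.dist w.1 u.1 + H.dist w.2 u.2 < G.dist w.1 v.1 + H.dist w.2 v.2) : False := by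
  obtain ⟨u₁, u₂⟩ := u
  obtain ⟨v₁, v₂⟩ := v
  obtain ⟨w₁, w₂⟩ := w
  simp only at *
  have triG := fun a b d : V => hG.dist_triangle (u := a) (v := b) (w := d)
  have triH := fun a b d : W => hH.dist_triangle (u := a) (v := b) (w := d)
  have hB := hG.boxProd hH
  have dB : ∀ p q : V × W, (G.boxProd H).dist p q = G.dist p.1 q.1 + H.dist p.2 q.2 :=
    hG.dist_boxProd hH
  -- Walk from `v` back to `u`: interior vertices have color `r` by minimality, so none is as far
  -- from `w` as `u` is. Distance to `w` changes by at most one per step, hence stays larger.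
  have far : ∀ n, ∀ p : V × W, (G.boxProd H).dist p (v₁, v₂) = n →
      (G.boxProd H).dist (u₁, u₂) p + (G.boxProd H).dist p (v₁, v₂) =
        (G.boxProd H).dist (u₁, u₂) (v₁, v₂) → p ≠ (u₁, u₂) →
      (G.boxProd H).dist (w₁, w₂) (u₁, u₂) < (G.boxProd H).dist (w₁, w₂) p := by
    intro n
    induction n with
    | zero =>
      intro p hp _ _
      rw [hB.dist_eq_zero_iff] at hp
      rw [hp, dB, dB]
      exact hlt
    | succ n ih =>
      intro p hp hgeo hpu
      have hpv : p ≠ (v₁, v₂) := by rintro rfl; simp at hp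
      obtain ⟨q, hpq, hq⟩ := hB.exists_adj_dist_add_one hpv
      have d1 := dist_eq_one_iff_adj.2 hpq
      have d2 := dist_eq_one_iff_adj.2 hpq.symm
      have t1 := hB.dist_triangle (u := (u₁, u₂)) (v := p) (w := q)
      have t2 := hB.dist_triangle (u := (u₁, u₂)) (v := q) (w := (v₁, v₂))
      have t3 := hB.dist_triangle (u := (w₁, w₂)) (v := p) (w := q)
      have p1 := hB.pos_dist_of_ne hpu.symm
      have hqu : q ≠ (u₁, u₂) := by
        rintro rfl
        omega
      have hlt' := ih q (by omega) (by omega) hqu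
      have hred : c p.1 p.2 = r := by
        by_contra hpr
        have m1 := hmin p (v₁, v₂) hpr hvr
        have m2 := hmin (u₁, u₂) p hur hpr
        rw [← dB] at m1 m2
        rw [← dB (u₁, u₂) (v₁, v₂)] at m1 m2
        by_cases e : c p.1 p.2 = c v₁ v₂
        · have := m2 (by rw [e]; exact huv)
          omega
        · have := m1 e
          omega
      have hne : (G.boxProd H).dist (w₁, w₂) p ≠ (G.boxProd H).dist (w₁, w₂) (u₁, u₂) := by
        intro e
        rw [dist_comm, dB, dB] at e
        have := hc p.1 w₁ u₁ p.2 w₂ u₂ e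
        grind
      omega
  have ne1 : u₁ ≠ v₁ := by
    rintro rfl
    exact huv (hr u₂ v₂ u₁ hur hvr)
  have ne2 : u₂ ≠ v₂ := by
    rintro rfl
    exact huv (hl u₁ v₁ u₂ hur hvr)
  have ne3 : u₁ ≠ w₁ := by
    rintro rfl
    exact hwu (hr w₂ u₂ u₁ hwr hur)
  obtain ⟨x, hx, dx⟩ := hG.exists_adj_dist_add_one ne1
  obtain ⟨h, hh, dh⟩ := hH.exists_adj_dist_add_one ne2
  obtain ⟨z, hz, dz⟩ := hG.exists_adj_dist_add_one ne3
  have ax := dist_eq_one_iff_adj.2 hx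
  have ah := dist_eq_one_iff_adj.2 hh
  have az := dist_eq_one_iff_adj.2 hz
  have az' := dist_eq_one_iff_adj.2 hz.symm
  have f2 := far _ (u₁, h) rfl (by simp only [dB, dist_self]; omega)
    (fun e => hh.ne' (congrArg Prod.snd e))
  simp only [dB] at f2
  have t1 := triH w₂ u₂ h
  rw [G.dist_comm (u := z), G.dist_comm (u := u₁) (v := w₁)] at dz
  -- Moving to `h` costs one step and moving to `z` regains it, so `(z, h)` is as far from `w` as
  -- `u` is.
  have e1 := hc u₁ w₁ z u₂ w₂ h (by
    rw [G.dist_comm (u := u₁), H.dist_comm (u := u₂)]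
    omega)
  have hcorner : c z h = c u₁ u₂ := by
    by_contra hne
    have hzw : c z h = c w₁ w₂ := by grind
    have a1 := hr h u₂ u₁
    have a2 := hl z u₁ h
    have a3 := hc u₁ u₁ z u₂ h h (by simp [ah, az])
    grind
  -- `(z, h)` can replace `u`: it is no farther from `v` but has smaller `H`-distance, against the
  -- tie-break `hmin'`.
  have t2 := triG z u₁ v₁
  have m1 := hmin (z, h) (v₁, v₂)
  have m2 := hmin' (z, h) (v₁, v₂)
  simp only [hcorner] at m1 m2
  have m1 := m1 hur hvr huv
  have m2 := m2 hur hvr huv (by omega)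
  omega

theorem RainbowFree.not_surjective {c : V → W → Fin 4} [Nontrivial V] [Nontrivial W]
    (hc : RainbowFree G H c) (hG : G.Connected) (hH : H.Connected)
    (hs : ∀ i, ∃ x h, c x h = i) : False := by
  have h2 := hc.locallyTwoValued hG hH
  obtain ⟨r, hl⟩ := h2.exists_dominated hG hH hs
  obtain ⟨r', hr⟩ := h2.swap.exists_dominated hH hG
    (fun i => let ⟨x, h, e⟩ := hs i; ⟨h, x, e⟩)
  obtain rfl := hl.eq_of_swap hr hs
  let φ : (V × W) × (V × W) → ℕ := fun t => G.dist t.1.1 t.2.1 + H.dist t.1.2 t.2.2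
  let S : Set ((V × W) × (V × W)) :=
    {t | c t.1.1 t.1.2 ≠ r ∧ c t.2.1 t.2.2 ≠ r ∧ c t.1.1 t.1.2 ≠ c t.2.1 t.2.2}
  have hS : S.Nonempty := by
    obtain ⟨x, h, h1, -⟩ := exists_apply_ne_of_surjective hs r r r
    obtain ⟨y, k, h3, h4, -⟩ := exists_apply_ne_of_surjective hs r (c x h) r
    exact ⟨((x, h), (y, k)), h1, h3, h4.symm⟩
  obtain ⟨t, ht, hmin⟩ := (measure φ).wf.has_min S hS
  obtain ⟨⟨u, v⟩, ⟨⟨hu, hv, huv⟩, hφ⟩, hmin'⟩ := (measure fun t : (V × W) × (V × W) =>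
    H.dist t.1.2 t.2.2).wf.has_min {s | s ∈ S ∧ φ s = φ t} ⟨t, ht, rfl⟩
  have m1 : ∀ p q : V × W, c p.1 p.2 ≠ r → c q.1 q.2 ≠ r → c p.1 p.2 ≠ c q.1 q.2 →
      G.dist u.1 v.1 + H.dist u.2 v.2 ≤ G.dist p.1 q.1 + H.dist p.2 q.2 :=
    fun p q h1 h2 h3 => (le_of_eq hφ).trans (not_lt.1 (hmin (p, q) ⟨h1, h2, h3⟩))
  have m2 : ∀ p q : V × W, c p.1 p.2 ≠ r → c q.1 q.2 ≠ r → c p.1 p.2 ≠ c q.1 q.2 →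
      G.dist p.1 q.1 + H.dist p.2 q.2 = G.dist u.1 v.1 + H.dist u.2 v.2 →
      H.dist u.2 v.2 ≤ H.dist p.2 q.2 :=
    fun p q h1 h2 h3 e => not_lt.1 (hmin' (p, q) ⟨⟨h1, h2, h3⟩, e.trans hφ⟩)
  obtain ⟨x, h, hw, hwu, hwv⟩ := exists_apply_ne_of_surjective hs r (c u.1 u.2) (c v.1 v.2)
  rcases lt_trichotomy (G.dist x u.1 + H.dist h u.2) (G.dist x v.1 + H.dist h v.2) with e | e | e
  · exact hc.false_of_minimal hG hH hl hr hu hv (w := (x, h)) hw huv hwu hwv m1 m2 e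
  · have := hc u.1 x v.1 u.2 h v.2 (by rw [G.dist_comm (u := u.1), H.dist_comm (u := u.2)]; exact e)
    grind
  · refine hc.false_of_minimal hG hH hl hr hv hu (w := (x, h)) hw huv.symm hwv hwu ?_ ?_ e
    · rwa [G.dist_comm (u := v.1), H.dist_comm (u := v.2)]
    · rwa [G.dist_comm (u := v.1), H.dist_comm (u := v.2)]

theorem rainbowFree_of_not_hasRainbowAP {c : V × W → C} (hG : G.Connected) (hH : H.Connected)
    (hc : ¬ (G.boxProd H).HasRainbowAP c 3) : RainbowFree G H (fun x h => c (x, h)) := by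
  intro x y z h k l e
  by_contra! hne
  refine hc ⟨![(x, h), (y, k), (z, l)], ⟨G.dist x y + H.dist h k, fun i hi => ?_⟩, ?_⟩
  · obtain rfl | rfl : i = 0 ∨ i = 1 := by omega
    · simp [hG.dist_boxProd hH]
    · simp [hG.dist_boxProd hH, e]
  · intro i j hij
    fin_cases i <;> fin_cases j <;> simp_all

end SimpleGraph

theorem mainTheorem1 {V W : Type*} [Finite V] [Finite W]
    (G : SimpleGraph V) (H : SimpleGraph W) (hG : G.Connected) (hH : H.Connected)
    (hV : 2 ≤ Nat.card V) (hW : 2 ≤ Nat.card W) :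
    SimpleGraph.aw (SimpleGraph.boxProd G H) 3 ≤ 4 ∧
      ∀ c : V × W → Fin 4, Function.Surjective c →
        (SimpleGraph.boxProd G H).HasRainbowAP c 3 := by
  have main : ∀ c : V × W → Fin 4, Function.Surjective c →
      (SimpleGraph.boxProd G H).HasRainbowAP c 3 := by
    intro c hs
    have : Nontrivial V := Finite.one_lt_card_iff_nontrivial.1 hV
    have : Nontrivial W := Finite.one_lt_card_iff_nontrivial.1 hW
    by_contra hc
    refine (SimpleGraph.rainbowFree_of_not_hasRainbowAP hG hH hc).not_surjective hG hH
      (fun i => ?_)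
    obtain ⟨⟨x, h⟩, e⟩ := hs i
    exact ⟨x, h, e⟩
  exact ⟨Nat.sInf_le ⟨by norm_num, main⟩, main⟩
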